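/- Let $R>0$ and $n\in\mathbb{N}$, let $h:[-R,R]^n\to\mathbb{R}$ be continuous, and let $\mu$ be a Borel probability measure on $[-R,R]^n$ with marginals $\mu_1,\dots,\mu_n$ on $[-R,R]$. We use the following notions. The Gibbs measure of a continuous function $f$ on $[-R,R]^m$ is the probability measure $Z_f^{-1}e^{f(\mathbf{x})}\,d\mathbf{x}$ with $Z_f=\int_{[-R,R]^m}e^{f(\mathbf{x})}\,d\mathbf{x}$. The marginal potentials of $h$ are the functions $$h_i(x)=\log\int_{[-R,R]^{n-1}}e^{h(x_1,\dots,x_{i-1},x,x_{i+1},\dots,x_n)}\,dx_1\cdots dx_{i-1}\,dx_{i+1}\cdots dx_n,\qquad x\in[-R,R],\ 1\le i\le n.$$ An approximating sequence for $(\mu_1,\dots,\mu_n)$ is a sequence $\Xi(N)=(\xi_1(N),\dots,\xi_n(N))$, $N\in\mathbb{N}$, of $n$-tuples of vectors $\xi_i(N)=(\xi_{i1}(N),\dots,\xi_{iN}(N))\in[-R,R]^N$ with $\xi_{i1}(N)\le\dots\le\xi_{iN}(N)$ such that $\frac1N\sum_{j=1}^N\xi_{ij}(N)^k\to\int x^k\,d\mu_i(x)$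 as $N\to\infty$ for all $k\in\mathbb{N}$ and $1\le i\le n$. Such sequences exist; let $\Xi$ be any one of them. For continuous $f:[-R,R]^n\to\mathbb{R}$ the mutual pressure of $f$ with respect to $(\mu_1,\dots,\mu_n)$ is $$P_{\mathrm{sym}}(f:\mu_1,\dots,\mu_n)=\limsup_{N\to\infty}\frac1N\log\Biggl[\frac1{(N!)^n}\sum_{\sigma_1,\dots,\sigma_n\in S_N}\exp\Biggl(\sum_{j=1}^N f\bigl(\xi_{1\sigma_1^{-1}(j)}(N),\dots,\xi_{n\sigma_n^{-1}(j)}(N)\bigr)\Biggr)\Biggr].$$ Let $$\mathcal{I}_{\mathrm{sym}}(\mu)=\sup\Bigl\{\int f\,d\mu-P_{\mathrm{sym}}(f:\mu_1,\dots,\mu_n)\ :\ f\in C_{\mathbb{R}}([-R,R]^n)\Bigr\}\in(-\infty,+\infty].$$ The measure $\mu$ is called mutually equilibrium associated with $h$ if $\mathcal{I}_{\mathrm{sym}}(\mu)=\int h\,d\mu-P_{\mathrm{sym}}(h:\mu_1,\dots,\mu_n)$. Then, for every choice of the approximating sequence $\Xi$, the following are equivalent: (i) $\mu$ is the Gibbs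 measure of $h$; (ii) $\mu$ is mutually equilibrium associated with $h$, and $\mu_i$ is the Gibbs measure of $h_i$ for each $i=1,\dots,n$. -/

import Mathlib

open MeasureTheory Filter Topology

noncomputable section

namespace MutualPressure

/-- The interval `[-R, R]`. -/
abbrev Seg (R : ℝ) : Type := Set.Icc (-R) R

/-- The `volume` of `[-R, R]` is Lebesgue measure on the interval. -/
instance instMeasureSpaceSeg (R : ℝ) : MeasureSpace (Seg R) := Measure.Subtype.measureSpace

/-- The cube `[-R, R]^n`. Its `volume`, the product measure, is `n`-dimensional Lebesgue measure
on the cube. -/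
abbrev Cube (R : ℝ) (n : ℕ) : Type := Fin n → Seg R

/-- The Gibbs measure `Z⁻¹ e^{f(x)} dx`, `Z = ∫ e^{f(x)} dx`, of a potential `f`
(used for `X = [-R, R]^n` and for `X = [-R, R]`). -/
def gibbsMeasure {X : Type*} [MeasureSpace X] (f : X → ℝ) : Measure X :=
  (volume : Measure X).withDensity
    fun x => ENNReal.ofReal (Real.exp (f x) / ∫ y, Real.exp (f y))

/-- The `i`-th marginal of a measure on the cube. -/
def marginal {R : ℝ} {n : ℕ} (μ : Measure (Cube R n)) (i : Fin n) : Measure (Seg R) :=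
  μ.map fun x => x i

/-- The point of the cube with `i`-th coordinate `x` and the other coordinates given by `y`. -/
def insertCoord {R : ℝ} {n : ℕ} (i : Fin n) (x : Seg R) (y : {j : Fin n // j ≠ i} → Seg R) :
    Cube R n :=
  fun j => if hj : j = i then x else y ⟨j, hj⟩

/-- The marginal potential
`h_i(x) = log ∫ e^{h(x_1, …, x_{i-1}, x, x_{i+1}, …, x_n)} dx_1 ⋯ dx_{i-1} dx_{i+1} ⋯ dx_n`,
the integral being over `[-R, R]^{n-1}`, with coordinates indexed by the `j ≠ i`. -/
def marginalPotential {R : ℝ} {n : ℕ} (h : C(Cube R n, ℝ)) (i : Fin n) (x : Seg R) : ℝ :=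
  Real.log (∫ y : {j : Fin n // j ≠ i} → Seg R, Real.exp (h (insertCoord i x y)))

/-- The mean value `κ_N(x) = (x_1 + ⋯ + x_N) / N`. -/
def mean {N : ℕ} (x : Fin N → ℝ) : ℝ := (N : ℝ)⁻¹ * ∑ j, x j

/-- `Ξ` is an approximating sequence for `(ν_1, …, ν_n)`: each `Ξ N i` is a vector in
`[-R, R]^N` with increasing coordinates, and `Ξ N i → ν_i` in moments as `N → ∞`. -/
structure IsApproximating {R : ℝ} {n : ℕ} (Ξ : (N : ℕ) → Fin n → Fin N → Seg R)
    (ν : Fin n → Measure (Seg R)) : Prop where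
  monotone : ∀ N i, Monotone (Ξ N i)
  tendsto_moment : ∀ (i : Fin n) (k : ℕ),
    Tendsto (fun N => mean fun j => (Ξ N i j : ℝ) ^ k) atTop (𝓝 (∫ x, (x : ℝ) ^ k ∂ν i))

/-- Every tuple of probability measures on `[-R, R]` has an approximating sequence
(sorted samples of independent variables). -/
theorem exists_isApproximating {R : ℝ} {n : ℕ} (ν : Fin n → Measure (Seg R))
    [∀ i, IsProbabilityMeasure (ν i)] :
    ∃ Ξ : (N : ℕ) → Fin n → Fin N → Seg R, IsApproximating Ξ ν := by
  have key : ∀ i, ∃ ω : ℕ → Seg R, ∀ k : ℕ,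
      Tendsto (fun N : ℕ => (∑ j ∈ Finset.range N, (ω j : ℝ) ^ k) / (N : ℝ)) atTop
        (𝓝 (∫ x, (x : ℝ) ^ k ∂ν i)) := by
    intro i
    let P : Measure (ℕ → Seg R) := Measure.infinitePi fun _ => ν i
    have hm : ∀ k : ℕ, Measurable fun x : Seg R => (x : ℝ) ^ k := fun k => by fun_prop
    have hmp : ∀ j : ℕ, MeasurePreserving (fun ω : ℕ → Seg R => ω j) P (ν i) := fun j =>
      measurePreserving_eval_infinitePi (fun _ => ν i) j
    have hae : ∀ᵐ ω ∂P, ∀ k : ℕ,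
        Tendsto (fun N : ℕ => (∑ j ∈ Finset.range N, (ω j : ℝ) ^ k) / (N : ℝ)) atTop
          (𝓝 (∫ x, (x : ℝ) ^ k ∂ν i)) := by
      rw [ae_all_iff]
      intro k
      have hint : Integrable (fun x : Seg R => (x : ℝ) ^ k) (ν i) :=
        Continuous.integrable_of_hasCompactSupport (by fun_prop) (HasCompactSupport.of_compactSpace _)
      have hI : ProbabilityTheory.iIndepFun (fun (j : ℕ) (ω : ℕ → Seg R) => (ω j : ℝ) ^ k) P :=
        ProbabilityTheory.iIndepFun_infinitePi (P := fun _ => ν i)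
          (X := fun _ x => (x : ℝ) ^ k) (fun _ => hm k)
      have := ProbabilityTheory.strong_law_ae_real
        (fun (j : ℕ) (ω : ℕ → Seg R) => (ω j : ℝ) ^ k) (μ := P)
        ((hmp 0).integrable_comp_of_integrable hint)
        (fun a b hab => hI.indepFun hab)
        (fun j =>
          { aemeasurable_fst := ((hm k).comp (measurable_pi_apply j)).aemeasurable
            aemeasurable_snd := ((hm k).comp (measurable_pi_apply 0)).aemeasurable
            map_eq := by
              have h1 := Measure.map_map (μ := P) (hm k) (measurable_pi_apply j)
              have h2 := Measure.map_map (μ := P) (hm k) (measurable_pi_apply 0)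
              rw [(hmp j).map_eq] at h1
              rw [(hmp 0).map_eq] at h2
              exact h1.symm.trans h2 })
      have he : (∫ ω, (ω 0 : ℝ) ^ k ∂P) = ∫ x, (x : ℝ) ^ k ∂ν i := by
        rw [← (hmp 0).map_eq, integral_map (measurable_pi_apply 0).aemeasurable
          (hm k).aestronglyMeasurable]
      rw [← he]
      exact this
    exact hae.exists
  choose ω hω using key
  refine ⟨fun N i => (fun j : Fin N => ω i j) ∘ Tuple.sort (fun j : Fin N => ω i j),
    fun N i => Tuple.monotone_sort _, fun i k => (hω i k).congr fun N => ?_⟩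
  rw [mean, div_eq_inv_mul, Finset.sum_range fun j => (ω i j : ℝ) ^ k]
  congr 1
  exact (Equiv.sum_comp (Tuple.sort fun j : Fin N => ω i j)
    (fun j : Fin N => (ω i j : ℝ) ^ k)).symm

/-- The `N`-th term in the definition of the mutual pressure:
`(1/N) log [(N!)^{-n} ∑_{σ_1, …, σ_n ∈ S_N} exp (N κ_N(h(σ_1(ξ_1), …, σ_n(ξ_n))))]`,
where `σ(x)_j = x_{σ⁻¹(j)}`. -/
def mutualPressureTerm {R : ℝ} {n N : ℕ} (ξ : Fin n → Fin N → Seg R) (h : C(Cube R n, ℝ)) : ℝ :=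
  (N : ℝ)⁻¹ * Real.log (((N.factorial : ℝ) ^ n)⁻¹ *
    ∑ σ : Fin n → Equiv.Perm (Fin N),
      Real.exp (N * mean fun j => h fun i => ξ i ((σ i)⁻¹ j)))

/-- The mutual pressure of `h`, computed along the sequence `Ξ`. The terms lie in
`[-‖h‖, ‖h‖]`, so that the `limsup` of reals is the usual one. When `Ξ` is an approximating
sequence for `(ν_1, …, ν_n)` this is the mutual pressure `P_sym(h : ν_1, …, ν_n)`. -/
def mutualPressure {R : ℝ} {n : ℕ} (Ξ : (N : ℕ) → Fin n → Fin N → Seg R)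
    (h : C(Cube R n, ℝ)) : ℝ :=
  limsup (fun N => mutualPressureTerm (Ξ N) h) atTop

/-- The Legendre transform `sup {μ(f) - P_sym(f) : f ∈ C([-R, R]^n)} ∈ (-∞, ∞]` of the mutual
pressure, for `Ξ` an approximating sequence of the marginals of `μ`. -/
def mutualInfo {R : ℝ} {n : ℕ} (Ξ : (N : ℕ) → Fin n → Fin N → Seg R)
    (μ : Measure (Cube R n)) : EReal :=
  ⨆ f : C(Cube R n, ℝ), (((∫ x, f x ∂μ) - mutualPressure Ξ f : ℝ) : EReal)

/-- `μ` is mutually equilibrium associated with `h`: the supremum defining the Legendre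
transform is finite and attained at `h`. Here `Ξ` is an approximating sequence of the
marginals of `μ`. -/
def IsMutuallyEquilibrium {R : ℝ} {n : ℕ} (Ξ : (N : ℕ) → Fin n → Fin N → Seg R)
    (μ : Measure (Cube R n)) (h : C(Cube R n, ℝ)) : Prop :=
  mutualInfo Ξ μ = (((∫ x, h x ∂μ) - mutualPressure Ξ h : ℝ) : EReal)

end MutualPressure

end

noncomputable section

namespace MutualPressure

open ProbabilityTheory
open scoped BigOperators

/-!
Write `P` for the mutual pressure and `π` for the product of the marginals. `P` is convex, and
`P(f) ≤ log ∫ e^f dπ` for every `f`, with equality as soon as tilting `π` by `e^f` preserves the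
marginals. Indeed, the law of `N` independent points of the cube distributed by `π` is invariant
under independent permutations of the coordinates, so that `(∫ e^f dπ)^N` is an integral of averages
over permutations. On typical samples these averages agree with the one along `Ξ` up to a
subexponential factor, since two sorted samples with nearly the same statistics are nearly matched.

At a potential `g` where equality holds, `P` thus lies below a function with derivative
`∫ f d(π tilted by g)` in the direction `f`, and touches it, so the tilted measure is the only
subgradient of `P` at `g`. Adding functions of single coordinates to the potential shifts `P` by
their integrals and does not affect equilibrium, so `h` may be replaced by `g = h - ∑ h_i(x_i)`,
for which `π` tilted by `g` is the Gibbs measure of `h` when `π` is the product of its marginals.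
-/

section PermAverage

lemma convexOn_log_expect_exp {S : Type*} [Fintype S] [Nonempty S] :
    ConvexOn ℝ Set.univ fun u : S → ℝ => Real.log (𝔼 s, Real.exp (u s)) := by
  have hpos : ∀ u : S → ℝ, 0 < 𝔼 s, Real.exp (u s) := fun u =>
    Finset.expect_pos (fun _ _ => Real.exp_pos _) Finset.univ_nonempty
  refine ⟨convex_univ, fun u _ v _ a b ha hb hab => ?_⟩
  set U := Real.log (𝔼 s, Real.exp (u s)) with hU
  set V := Real.log (𝔼 s, Real.exp (v s)) with hV
  have hu : 𝔼 s, Real.exp (u s - U) = 1 := by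
    simp only [hU, Real.exp_sub, Real.exp_log (hpos u), ← Finset.expect_div,
      div_self (hpos u).ne']
  have hv : 𝔼 s, Real.exp (v s - V) = 1 := by
    simp only [hV, Real.exp_sub, Real.exp_log (hpos v), ← Finset.expect_div,
      div_self (hpos v).ne']
  rw [Real.log_le_iff_le_exp (hpos _)]
  calc 𝔼 s, Real.exp ((a • u + b • v) s)
      = Real.exp (a • U + b • V) * 𝔼 s, Real.exp (a • (u s - U) + b • (v s - V)) := by
        simp only [Finset.mul_expect, ← Real.exp_add, Pi.add_apply, Pi.smul_apply, smul_eq_mul]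
        ring_nf
    _ ≤ Real.exp (a • U + b • V) *
          𝔼 s, (a • Real.exp (u s - U) + b • Real.exp (v s - V)) := by
        gcongr with s
        exact convexOn_exp.2 (Set.mem_univ _) (Set.mem_univ _) ha hb hab
    _ = Real.exp (a • U + b • V) := by
        rw [Finset.expect_add_distrib, ← Finset.smul_expect, ← Finset.smul_expect, hu, hv,
          ← add_smul, hab, one_smul, mul_one]

variable {ι κ X : Type*} [Fintype ι] [DecidableEq ι] [Fintype κ] [DecidableEq κ]

/-- The average of `exp (∑ j, f (x_{i σ_i⁻¹(j)})_i)` over all families of permutations `σ`: the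
partition function inside `mutualPressureTerm`. -/
def permAverage (x : ι → κ → X) (f : (ι → X) → ℝ) : ℝ :=
  𝔼 σ : ι → Equiv.Perm κ, Real.exp (∑ j, f fun i => x i ((σ i)⁻¹ j))

lemma permAverage_pos (x : ι → κ → X) (f : (ι → X) → ℝ) : 0 < permAverage x f :=
  Finset.expect_pos (fun _ _ => Real.exp_pos _) Finset.univ_nonempty

lemma permAverage_comp_perm (x : ι → κ → X) (τ : ι → Equiv.Perm κ) (f : (ι → X) → ℝ) :
    permAverage (fun i => x i ∘ τ i) f = permAverage x f :=
  Fintype.expect_equiv (Equiv.mulRight fun i => (τ i)⁻¹) _ _ fun σ => by simp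

lemma permAverage_le_exp_mul {x ξ : ι → κ → X} {f g : (ι → X) → ℝ} {D : ℝ}
    (h : ∀ σ : ι → Equiv.Perm κ,
      (∑ j, f fun i => x i ((σ i)⁻¹ j)) ≤ D + ∑ j, g fun i => ξ i ((σ i)⁻¹ j)) :
    permAverage x f ≤ Real.exp D * permAverage ξ g := by
  simp only [permAverage, Finset.mul_expect, ← Real.exp_add]
  exact Finset.expect_le_expect fun σ _ => Real.exp_le_exp.2 (h σ)

lemma permAverage_const (x : ι → κ → X) (c : ℝ) :
    permAverage x (Function.const _ c) = Real.exp (Fintype.card κ * c) := by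
  simp [permAverage]

lemma continuous_permAverage [TopologicalSpace X] {f : (ι → X) → ℝ} (hf : Continuous f) :
    Continuous fun x : ι → κ → X => permAverage x f := by
  simp only [permAverage, Fintype.expect_eq_sum_div_card]
  fun_prop

end PermAverage

section MutualPressureTerm

variable {R : ℝ} {n N : ℕ} (ξ : Fin n → Fin N → Seg R)

lemma natCast_mul_mean (x : Fin N → ℝ) : (N : ℝ) * mean x = ∑ j, x j := by
  rcases eq_or_ne N 0 with rfl | hN
  · simp [mean]
  · rw [mean, mul_inv_cancel_left₀ (Nat.cast_ne_zero.2 hN)]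

lemma mutualPressureTerm_eq (f : C(Cube R n, ℝ)) :
    mutualPressureTerm ξ f = (N : ℝ)⁻¹ * Real.log (permAverage ξ f) := by
  simp [mutualPressureTerm, permAverage, natCast_mul_mean, Fintype.expect_eq_sum_div_card,
    Fintype.card_perm, div_eq_inv_mul]

lemma convexOn_mutualPressureTerm :
    ConvexOn ℝ Set.univ fun f : C(Cube R n, ℝ) => mutualPressureTerm ξ f := by
  let energy : C(Cube R n, ℝ) →ₗ[ℝ] (Fin n → Equiv.Perm (Fin N)) → ℝ :=
    { toFun := fun f σ => ∑ j, f fun i => ξ i ((σ i)⁻¹ j)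
      map_add' := fun f g => funext fun σ => Finset.sum_add_distrib
      map_smul' := fun c f => funext fun σ => (Finset.mul_sum _ _ _).symm }
  simp only [mutualPressureTerm_eq]
  exact (convexOn_log_expect_exp.comp_linearMap energy).smul (inv_nonneg.2 N.cast_nonneg)

variable {ξ} {f g : C(Cube R n, ℝ)}

lemma mutualPressureTerm_le_iff (hN : N ≠ 0) {b : ℝ} :
    mutualPressureTerm ξ f ≤ b ↔ permAverage ξ f ≤ Real.exp (N * b) := by
  rw [mutualPressureTerm_eq, inv_mul_le_iff₀ (by positivity),
    Real.log_le_iff_le_exp (permAverage_pos ξ f)]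

lemma le_mutualPressureTerm_iff (hN : N ≠ 0) {b : ℝ} :
    b ≤ mutualPressureTerm ξ f ↔ Real.exp (N * b) ≤ permAverage ξ f := by
  rw [mutualPressureTerm_eq, le_inv_mul_iff₀ (by positivity),
    Real.le_log_iff_exp_le (permAverage_pos ξ f)]

lemma mutualPressureTerm_le_add {c : ℝ} (hN : N ≠ 0)
    (h : permAverage ξ f ≤ Real.exp (N * c) * permAverage ξ g) :
    mutualPressureTerm ξ f ≤ c + mutualPressureTerm ξ g := by
  rw [mutualPressureTerm_le_iff hN, mul_add, Real.exp_add]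
  exact h.trans (mul_le_mul_of_nonneg_left ((mutualPressureTerm_le_iff hN).1 le_rfl)
    (Real.exp_pos _).le)

lemma mutualPressureTerm_const (hN : N ≠ 0) (c : ℝ) :
    mutualPressureTerm ξ (ContinuousMap.const _ c) = c := by
  rw [mutualPressureTerm_eq, ContinuousMap.coe_const, permAverage_const, Real.log_exp,
    Fintype.card_fin, inv_mul_cancel_left₀ (Nat.cast_ne_zero.2 hN)]

lemma mutualPressureTerm_mono (hN : N ≠ 0) (h : f ≤ g) :
    mutualPressureTerm ξ f ≤ mutualPressureTerm ξ g := by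
  have hle := mutualPressureTerm_le_add (ξ := ξ) (f := f) (g := g) (c := 0) hN
    (permAverage_le_exp_mul fun σ => by
      rw [mul_zero, zero_add]
      exact Finset.sum_le_sum fun j _ => h _)
  rwa [zero_add] at hle

lemma abs_mutualPressureTerm_le (hN : N ≠ 0) : |mutualPressureTerm ξ f| ≤ ‖f‖ := by
  rw [abs_le]
  constructor
  · rw [← mutualPressureTerm_const (ξ := ξ) hN (-‖f‖)]
    exact mutualPressureTerm_mono hN fun x => (abs_le.1 (f.norm_coe_le_norm x)).1
  · rw [← mutualPressureTerm_const (ξ := ξ) hN ‖f‖]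
    exact mutualPressureTerm_mono hN fun x => (abs_le.1 (f.norm_coe_le_norm x)).2

end MutualPressureTerm

section Matching

lemma card_le_abs_sum_sub_sum {α : Type*} [LinearOrder α] {N : ℕ} {x ξ : Fin N → α}
    (hx : Monotone x) (hξ : Monotone ξ) {φ : α → ℝ} (hφ : Monotone φ)
    (hφ01 : ∀ s, φ s ∈ Set.Icc 0 1) :
    (Finset.card {j | φ (ξ j) = 0 ∧ φ (x j) = 1} : ℝ) ≤ |∑ j, φ (x j) - ∑ j, φ (ξ j)| := by
  by_cases! hsep : ∀ j, ¬ (φ (ξ j) = 0 ∧ φ (x j) = 1)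
  · simp [hsep]
  obtain ⟨j₀, hξ₀, hx₀⟩ := hsep
  -- The index `j₀` forces `φ ∘ ξ ≤ φ ∘ x`: below `j₀` the left side is `0`, above it the right
  -- side is `1`.
  have hle : ∀ j, φ (ξ j) ≤ φ (x j) := fun j => by
    rcases le_total j j₀ with hj | hj
    · exact (hφ (hξ hj)).trans (hξ₀.trans_le (hφ01 _).1)
    · exact (hφ01 _).2.trans (hx₀.symm.trans_le (hφ (hx hj)))
  refine le_trans ?_ (le_abs_self _)
  rw [← Finset.sum_sub_distrib, Finset.natCast_card_filter]
  refine Finset.sum_le_sum fun j _ => ?_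
  split_ifs with h
  · simp [h]
  · exact sub_nonneg.2 (hle j)

/-- The monotone function on `ℝ` that increases linearly from `0` at `a` to `1` at `a + l`. -/
def ramp (a l : ℝ) (s : ℝ) : ℝ := Set.projIcc 0 1 zero_le_one ((s - a) / l)

lemma continuous_ramp (a l : ℝ) : Continuous (ramp a l) :=
  continuous_subtype_val.comp (continuous_projIcc.comp (by fun_prop))

lemma monotone_ramp (a : ℝ) {l : ℝ} (hl : 0 ≤ l) : Monotone (ramp a l) := fun _ _ hst =>
  Set.monotone_projIcc _ (div_le_div_of_nonneg_right (sub_le_sub_right hst a) hl)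

lemma ramp_eq_zero {a l s : ℝ} (hl : 0 ≤ l) (hs : s ≤ a) : ramp a l s = 0 :=
  congrArg Subtype.val (Set.projIcc_of_le_left _ (div_nonpos_of_nonpos_of_nonneg
    (sub_nonpos.2 hs) hl))

lemma ramp_eq_one {a l s : ℝ} (hl : 0 < l) (hs : a + l ≤ s) : ramp a l s = 1 :=
  congrArg Subtype.val (Set.projIcc_of_right_le _ ((one_le_div hl).2 (by linarith)))

lemma exists_monotone_separating (R : ℝ) {η : ℝ} (hη : 0 < η) :
    ∃ (K : ℕ) (φ : Fin K → C(Seg R, ℝ)), (∀ k, Monotone (φ k)) ∧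
      (∀ k s, φ k s ∈ Set.Icc 0 1) ∧
      ∀ s t : Seg R, (s : ℝ) + η ≤ t → ∃ k, φ k s = 0 ∧ φ k t = 1 := by
  have hη2 : 0 < η / 2 := half_pos hη
  refine ⟨⌈2 * R / (η / 2)⌉₊ + 1, fun k => ⟨fun s => ramp (-R + k * (η / 2)) (η / 2) s,
    (continuous_ramp _ _).comp continuous_subtype_val⟩,
    fun k s t hst => monotone_ramp _ hη2.le hst, fun k s => Subtype.property _,
    fun s t hst => ?_⟩
  have hs0 : 0 ≤ (s + R) / (η / 2) := div_nonneg (by linarith [s.2.1]) hη2.le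
  have hk : ⌈(s + R) / (η / 2)⌉₊ < ⌈2 * R / (η / 2)⌉₊ + 1 :=
    Nat.lt_succ_of_le (Nat.ceil_mono (by gcongr; linarith [s.2.2]))
  refine ⟨⟨_, hk⟩, ramp_eq_zero hη2.le ?_, ramp_eq_one hη2 ?_⟩
  · have := (div_le_iff₀ hη2).1 (Nat.le_ceil ((s + R) / (η / 2)))
    dsimp only
    linarith
  · have := (lt_div_iff₀ hη2).1 (sub_lt_iff_lt_add.2 (Nat.ceil_lt_add_one hs0))
    dsimp only
    linarith

lemma card_le_dist_le {R η D : ℝ} {K N : ℕ} {φ : Fin K → Seg R → ℝ}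
    (hφ : ∀ k, Monotone (φ k)) (hφ01 : ∀ k s, φ k s ∈ Set.Icc 0 1)
    (hsep : ∀ s t : Seg R, (s : ℝ) + η ≤ t → ∃ k, φ k s = 0 ∧ φ k t = 1)
    {x ξ : Fin N → Seg R} (hx : Monotone x) (hξ : Monotone ξ)
    (hD : ∀ k, |∑ j, φ k (x j) - ∑ j, φ k (ξ j)| ≤ D) :
    (Finset.card {j | η ≤ dist (x j) (ξ j)} : ℝ) ≤ K * (2 * D) := by
  classical
  let sep (k : Fin K) (x ξ : Fin N → Seg R) : Finset (Fin N) := {j | φ k (ξ j) = 0 ∧ φ k (x j) = 1}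
  have hcover : ({j | η ≤ dist (x j) (ξ j)} : Finset (Fin N)) ⊆
      Finset.univ.biUnion fun k => sep k x ξ ∪ sep k ξ x := fun j hj => by
    simp only [Finset.mem_filter_univ, Subtype.dist_eq, Real.dist_eq, le_abs] at hj
    simp only [sep, Finset.mem_biUnion, Finset.mem_univ, true_and, Finset.mem_union,
      Finset.mem_filter_univ]
    rcases hj with hj | hj
    · exact (hsep (ξ j) (x j) (by linarith)).imp fun _ => Or.inl
    · exact (hsep (x j) (ξ j) (by linarith)).imp fun _ => Or.inr
  have hcard : ∀ k, ((sep k x ξ ∪ sep k ξ x).card : ℝ) ≤ 2 * D := fun k => by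
    have hx' := (card_le_abs_sum_sub_sum hx hξ (hφ k) (hφ01 k)).trans (hD k)
    have hξ' := (card_le_abs_sum_sub_sum hξ hx (hφ k) (hφ01 k)).trans
      ((abs_sub_comm _ _).trans_le (hD k))
    calc ((sep k x ξ ∪ sep k ξ x).card : ℝ) ≤ (sep k x ξ).card + (sep k ξ x).card := by
          exact_mod_cast Finset.card_union_le _ _
      _ ≤ 2 * D := by linarith
  calc (Finset.card {j | η ≤ dist (x j) (ξ j)} : ℝ)
      ≤ ∑ k, ((sep k x ξ ∪ sep k ξ x).card : ℝ) := by
        exact_mod_cast (Finset.card_le_card hcover).trans Finset.card_biUnion_le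
    _ ≤ ∑ _k : Fin K, 2 * D := Finset.sum_le_sum fun k _ => hcard k
    _ = K * (2 * D) := by simp

variable {ι κ X : Type*} [Fintype ι] [Fintype κ] [PseudoMetricSpace X]
  [CompactSpace X]

lemma abs_sub_le_add_card {f : C(ι → X, ℝ)} {η δ : ℝ} (hη : 0 < η) (hδ : 0 ≤ δ)
    (hf : ∀ a b, dist a b < η → |f a - f b| ≤ δ) (a b : ι → X) :
    |f a - f b| ≤ δ + 2 * ‖f‖ * Finset.card {i | η ≤ dist (a i) (b i)} := by
  by_cases! h : ∀ i, dist (a i) (b i) < η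
  · exact (hf a b ((dist_pi_lt_iff hη).2 h)).trans (le_add_of_nonneg_right (by positivity))
  obtain ⟨i, hi⟩ := h
  have hcard : (1 : ℝ) ≤ Finset.card {i | η ≤ dist (a i) (b i)} := by
    exact_mod_cast Finset.card_pos.2 ⟨i, by simpa using hi⟩
  calc |f a - f b| ≤ |f a| + |f b| := abs_sub _ _
    _ ≤ 2 * ‖f‖ * 1 := by
        rw [mul_one, two_mul]
        exact add_le_add (f.norm_coe_le_norm a) (f.norm_coe_le_norm b)
    _ ≤ 2 * ‖f‖ * Finset.card {i | η ≤ dist (a i) (b i)} := by gcongr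
    _ ≤ _ := le_add_of_nonneg_left hδ

lemma abs_sum_sub_sum_le {f : C(ι → X, ℝ)} {η δ B : ℝ} (hη : 0 < η) (hδ : 0 ≤ δ)
    (hf : ∀ a b, dist a b < η → |f a - f b| ≤ δ) {x ξ : ι → κ → X}
    (hB : ∀ i, (Finset.card {j | η ≤ dist (x i j) (ξ i j)} : ℝ) ≤ B) (σ : ι → Equiv.Perm κ) :
    |(∑ j, f fun i => x i (σ i j)) - ∑ j, f fun i => ξ i (σ i j)| ≤
      Fintype.card κ * δ + 2 * ‖f‖ * (Fintype.card ι * B) := by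
  have hcount : ∑ j, (Finset.card {i | η ≤ dist (x i (σ i j)) (ξ i (σ i j))} : ℝ) =
      ∑ i, (Finset.card {j | η ≤ dist (x i j) (ξ i j)} : ℝ) := by
    simp only [Finset.natCast_card_filter]
    rw [Finset.sum_comm]
    exact Finset.sum_congr rfl fun i _ =>
      Equiv.sum_comp (σ i) fun j => if η ≤ dist (x i j) (ξ i j) then (1 : ℝ) else 0
  calc |(∑ j, f fun i => x i (σ i j)) - ∑ j, f fun i => ξ i (σ i j)|
      ≤ ∑ j, |(f fun i => x i (σ i j)) - f fun i => ξ i (σ i j)| := by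
        rw [← Finset.sum_sub_distrib]
        exact Finset.abs_sum_le_sum_abs _ _
    _ ≤ ∑ j, (δ + 2 * ‖f‖ * Finset.card {i | η ≤ dist (x i (σ i j)) (ξ i (σ i j))}) :=
        Finset.sum_le_sum fun j _ => abs_sub_le_add_card hη hδ hf _ _
    _ = Fintype.card κ * δ + 2 * ‖f‖ * ∑ i, (Finset.card {j | η ≤ dist (x i j) (ξ i j)} : ℝ) := by
        rw [Finset.sum_add_distrib, ← Finset.mul_sum, hcount]
        simp
    _ ≤ _ := by
        gcongr
        simpa [Finset.card_univ] using Finset.sum_le_card_nsmul Finset.univ _ B fun i _ => hB i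

end Matching

lemma exists_permAverage_comparison {ι : Type*} [Fintype ι] [DecidableEq ι] {R : ℝ}
    (f : C(ι → Seg R, ℝ)) {δ : ℝ} (hδ : 0 < δ) :
    ∃ (K : ℕ) (φ : Fin K → C(Seg R, ℝ)) (ε : ℝ), 0 < ε ∧
      ∀ (N : ℕ) (x ξ : ι → Fin N → Seg R), (∀ i, Monotone (ξ i)) →
        (∀ i k, |∑ j, φ k (x i j) - ∑ j, φ k (ξ i j)| ≤ N * ε) →
        permAverage x f ≤ Real.exp (N * δ) * permAverage ξ f ∧
        permAverage ξ f ≤ Real.exp (N * δ) * permAverage x f := by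
  obtain ⟨η, hη, hf⟩ := Metric.uniformContinuous_iff.1
    (CompactSpace.uniformContinuous_of_continuous f.continuous) (δ / 2) (half_pos hδ)
  obtain ⟨K, φ, hφ, hφ01, hsep⟩ := exists_monotone_separating R hη
  obtain ⟨ε, hε, hεδ⟩ : ∃ ε > 0, 2 * ‖f‖ * (Fintype.card ι * (K * (2 * ε))) ≤ δ / 2 := by
    refine ⟨δ / 2 / (2 * ‖f‖ * (Fintype.card ι * (K * 2)) + 1), by positivity, ?_⟩
    rw [← mul_assoc (K : ℝ), ← mul_assoc (Fintype.card ι : ℝ), ← mul_assoc, mul_div_assoc',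
      div_le_iff₀ (by positivity)]
    linarith
  refine ⟨K, φ, ε, hε, fun N x ξ hξ hstat => ?_⟩
  -- The average over permutations does not see the order of the entries of `x i`.
  rw [← permAverage_comp_perm x (fun i => Tuple.sort (x i)) f]
  have hfar : ∀ i, (Finset.card {j | η ≤ dist ((x i ∘ Tuple.sort (x i)) j) (ξ i j)} : ℝ) ≤
      K * (2 * (N * ε)) := fun i =>
    card_le_dist_le hφ hφ01 hsep (Tuple.monotone_sort (x i)) (hξ i) fun k => by
      simpa only [Function.comp_apply, Equiv.sum_comp (Tuple.sort (x i)) fun j => φ k (x i j)]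
        using hstat i k
  have hclose : ∀ σ : ι → Equiv.Perm (Fin N),
      |(∑ j, f fun i => (x i ∘ Tuple.sort (x i)) ((σ i)⁻¹ j)) - ∑ j, f fun i => ξ i ((σ i)⁻¹ j)|
        ≤ N * δ := fun σ =>
    calc _ ≤ N * (δ / 2) + 2 * ‖f‖ * (Fintype.card ι * (K * (2 * (N * ε)))) := by
          simpa using abs_sum_sub_sum_le hη (half_pos hδ).le (fun a b hab => (hf hab).le) hfar
            fun i => (σ i)⁻¹
      _ = N * (δ / 2 + 2 * ‖f‖ * (Fintype.card ι * (K * (2 * ε)))) := by ring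
      _ ≤ N * δ := by gcongr; linarith
  exact ⟨permAverage_le_exp_mul fun σ => by linarith [(abs_le.1 (hclose σ)).2],
    permAverage_le_exp_mul fun σ => by linarith [(abs_le.1 (hclose σ)).1]⟩

lemma integrable_of_compactSpace {X : Type*} [TopologicalSpace X] [CompactSpace X]
    [MeasurableSpace X] [OpensMeasurableSpace X] {f : X → ℝ} (hf : Continuous f) (μ : Measure X)
    [IsFiniteMeasure μ] : Integrable f μ :=
  hf.integrable_of_hasCompactSupport (HasCompactSupport.of_compactSpace _)

lemma integrable_exp {X : Type*} [TopologicalSpace X] [CompactSpace X] [MeasurableSpace X]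
    [OpensMeasurableSpace X] {f : C(X, ℝ)} (μ : Measure X) [IsFiniteMeasure μ] :
    Integrable (fun x => Real.exp (f x)) μ :=
  integrable_of_compactSpace (by fun_prop) μ

section Tilted

lemma pi_tilted {ι : Type*} [Fintype ι] {X : ι → Type*} [∀ i, MeasurableSpace (X i)]
    (μ : ∀ i, Measure (X i)) [∀ i, SigmaFinite (μ i)] (v : ∀ i, X i → ℝ) :
    Measure.pi (fun i => (μ i).tilted (v i)) = (Measure.pi μ).tilted fun x => ∑ i, v i (x i) := by
  refine Measure.pi_eq fun s _ => ?_
  simp only [tilted_apply_eq_ofReal_integral, Measure.restrict_pi_pi, Real.exp_sum,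
    integral_div]
  rw [integral_fintype_prod_eq_prod fun i x => Real.exp (v i x),
    integral_fintype_prod_eq_prod fun i x => Real.exp (v i x), ← Finset.prod_div_distrib,
    ENNReal.ofReal_prod_of_nonneg fun i _ => by positivity]

lemma setIntegral_exp_sum {κ X : Type*} [Fintype κ] [MeasurableSpace X] (μ : Measure X)
    [SigmaFinite μ] [NeZero μ] {v : X → ℝ} (hv : Integrable (fun x => Real.exp (v x)) μ)
    (A : Set (κ → X)) :
    ∫ y in A, Real.exp (∑ j, v (y j)) ∂Measure.pi (fun _ : κ => μ) =
      (∫ x, Real.exp (v x) ∂μ) ^ Fintype.card κ *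
        (Measure.pi fun _ : κ => μ.tilted v).real A := by
  have hZ : ∫ y, Real.exp (∑ j, v (y j)) ∂Measure.pi (fun _ : κ => μ) =
      (∫ x, Real.exp (v x) ∂μ) ^ Fintype.card κ := by
    simp only [Real.exp_sum]
    exact integral_fintype_prod_eq_pow fun x => Real.exp (v x)
  rw [pi_tilted, measureReal_def, tilted_apply_eq_ofReal_integral, integral_div, hZ,
    ENNReal.toReal_ofReal (by positivity),
    mul_div_cancel₀ _ (pow_pos (integral_exp_pos hv) _).ne']

end Tilted

section Permutations

variable {ι κ X : Type*} [Fintype ι] [Fintype κ] [MeasurableSpace X]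
  (ν : ι → Measure X) [∀ i, IsProbabilityMeasure (ν i)]

lemma measurePreserving_curry_pi :
    MeasurePreserving (MeasurableEquiv.curry κ ι X)
      (Measure.pi fun p : κ × ι => ν p.2) (Measure.pi fun _ : κ => Measure.pi ν) := by
  refine ⟨MeasurableEquiv.measurable _, ?_⟩
  simpa only [Measure.infinitePi_eq_pi] using Measure.infinitePi_map_curry fun (_ : κ) i => ν i

lemma measurePreserving_permCoord (σ : ι → Equiv.Perm κ) :
    MeasurePreserving (fun (y : κ → ι → X) j i => y (σ i j) i)
      (Measure.pi fun _ : κ => Measure.pi ν) (Measure.pi fun _ : κ => Measure.pi ν) := by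
  let e : κ × ι ≃ κ × ι :=
    ((Equiv.prodComm κ ι).trans (Equiv.prodShear (Equiv.refl ι) σ)).trans (Equiv.prodComm ι κ)
  have hcurry := measurePreserving_curry_pi (κ := κ) ν
  have hperm : MeasurePreserving (MeasurableEquiv.arrowCongr' e.symm (MeasurableEquiv.refl X))
      (Measure.pi fun p => ν p.2) (Measure.pi fun p => ν p.2) :=
    measurePreserving_arrowCongr' _ _ _ _ fun p => MeasurePreserving.id (ν p.2)
  exact hcurry.comp (hperm.comp (hcurry.symm _))

variable [DecidableEq ι] [DecidableEq κ] [TopologicalSpace X] [CompactSpace X]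
  [SecondCountableTopology X] [OpensMeasurableSpace X]

lemma setIntegral_exp_sum_eq_permAverage (f : C(ι → X, ℝ)) {A : Set (κ → ι → X)}
    (hA : MeasurableSet A)
    (hinv : ∀ (σ : ι → Equiv.Perm κ) (y : κ → ι → X), (fun j i => y (σ i j) i) ∈ A ↔ y ∈ A) :
    ∫ y in A, Real.exp (∑ j, f (y j)) ∂Measure.pi (fun _ : κ => Measure.pi ν) =
      ∫ y in A, permAverage (fun i j => y j i) f ∂Measure.pi (fun _ : κ => Measure.pi ν) := by
  have hperm : ∀ σ : ι → Equiv.Perm κ,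
      ∫ y in A, Real.exp (∑ j, f fun i => y ((σ i)⁻¹ j) i)
        ∂Measure.pi (fun _ : κ => Measure.pi ν) =
      ∫ y in A, Real.exp (∑ j, f (y j)) ∂Measure.pi (fun _ : κ => Measure.pi ν) := fun σ => by
    have hT := measurePreserving_permCoord (κ := κ) ν fun i => (σ i)⁻¹
    have hF : Continuous fun y : κ → ι → X => Real.exp (∑ j, f (y j)) := by fun_prop
    conv_rhs => rw [← hT.map_eq]
    rw [setIntegral_map hA hF.aestronglyMeasurable hT.aemeasurable]
    congr 2
    ext y
    exact (hinv _ y).symm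
  simp only [permAverage, Fintype.expect_eq_sum_div_card]
  rw [integral_div, integral_finsetSum _ fun σ _ =>
    (integrable_of_compactSpace (by fun_prop) _).integrableOn]
  simp only [hperm]
  simp

end Permutations

section LawOfLargeNumbers

variable {X : Type*} [MeasurableSpace X] (Q : Measure X) [IsProbabilityMeasure Q] {ψ : X → ℝ}

lemma pi_real_abs_sum_sub_ge_le {κ : Type*} [Fintype κ] (hψ : MemLp ψ 2 Q) {c : ℝ} (hc : 0 < c) :
    (Measure.pi fun _ : κ => Q).real
        {y | c ≤ |∑ j, ψ (y j) - Fintype.card κ * ∫ x, ψ x ∂Q|} ≤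
      Fintype.card κ * variance ψ Q / c ^ 2 := by
  have hL : ∀ j : κ, MemLp (fun y : κ → X => ψ (y j)) 2 (Measure.pi fun _ : κ => Q) :=
    fun j => hψ.comp_measurePreserving (measurePreserving_eval (fun _ : κ => Q) j)
  have hmean : ∫ y, ∑ j, ψ (y j) ∂Measure.pi (fun _ : κ => Q) =
      Fintype.card κ * ∫ x, ψ x ∂Q := by
    rw [integral_finsetSum _ fun j _ => (hL j).integrable one_le_two]
    simp [integral_comp_eval (μ := fun _ : κ => Q) hψ.aestronglyMeasurable]
  have hvar : variance (fun y : κ → X => ∑ j, ψ (y j))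
      (Measure.pi fun _ : κ => Q) = Fintype.card κ * variance ψ Q := by
    simpa [Finset.sum_fn] using variance_sum_pi (μ := fun _ : κ => Q)
      (X := fun _ => ψ) fun _ => hψ
  have hcheb := meas_ge_le_variance_div_sq
    (memLp_finsetSum Finset.univ fun j _ => hL j) hc
  rw [hmean, hvar] at hcheb
  exact ENNReal.toReal_le_of_le_ofReal
    (by have := variance_nonneg ψ Q; positivity) hcheb

lemma tendsto_pi_real_abs_sum_sub_gt (hψ : MemLp ψ 2 Q) {c : ℕ → ℝ}
    (hc : Tendsto c atTop (𝓝 (∫ x, ψ x ∂Q))) {ε : ℝ} (hε : 0 < ε) :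
    Tendsto (fun N : ℕ => (Measure.pi fun _ : Fin N => Q).real
      {y | N * ε < |∑ j, ψ (y j) - N * c N|}) atTop (𝓝 0) := by
  have hlim : Tendsto (fun N : ℕ => variance ψ Q / (ε / 2) ^ 2 * (N : ℝ)⁻¹)
      atTop (𝓝 0) := by
    simpa only [mul_zero] using (tendsto_inv_atTop_nhds_zero_nat (𝕜 := ℝ)).const_mul
      (variance ψ Q / (ε / 2) ^ 2)
  refine squeeze_zero' (Eventually.of_forall fun _ => measureReal_nonneg) ?_ hlim
  filter_upwards [Metric.tendsto_nhds.1 hc (ε / 2) (half_pos hε), eventually_gt_atTop 0]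
    with N hN hN0
  have hN0 : (0 : ℝ) < N := Nat.cast_pos.2 hN0
  have hcenter : |(N : ℝ) * c N - N * ∫ x, ψ x ∂Q| ≤ N * (ε / 2) := by
    rw [← mul_sub, abs_mul, abs_of_pos hN0]
    exact mul_le_mul_of_nonneg_left hN.le hN0.le
  calc (Measure.pi fun _ : Fin N => Q).real {y | N * ε < |∑ j, ψ (y j) - N * c N|}
      ≤ (Measure.pi fun _ : Fin N => Q).real
          {y | N * (ε / 2) ≤ |∑ j, ψ (y j) - N * ∫ x, ψ x ∂Q|} := by
        refine measureReal_mono fun y hy => ?_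
        rw [Set.mem_ofPred_eq] at hy ⊢
        have := abs_sub_le (∑ j, ψ (y j)) (N * ∫ x, ψ x ∂Q) (N * c N)
        rw [abs_sub_comm (N * ∫ x, ψ x ∂Q)] at this
        linarith
    _ ≤ N * variance ψ Q / (N * (ε / 2)) ^ 2 := by
        simpa using pi_real_abs_sum_sub_ge_le (κ := Fin N) Q hψ (by positivity)
    _ = variance ψ Q / (ε / 2) ^ 2 * (N : ℝ)⁻¹ := by field_simp

end LawOfLargeNumbers

section Approximation

variable {R : ℝ} {n : ℕ} {Ξ : (N : ℕ) → Fin n → Fin N → Seg R}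

lemma abs_mean_sub_mean_le {N : ℕ} {x y : Fin N → ℝ} {δ : ℝ} (hδ : 0 ≤ δ)
    (h : ∀ j, |x j - y j| ≤ δ) : |mean x - mean y| ≤ δ := by
  rcases eq_or_ne N 0 with rfl | hN
  · simpa [mean] using hδ
  have hN : (0 : ℝ) < N := by positivity
  rw [mean, mean, ← mul_sub, ← Finset.sum_sub_distrib, abs_mul, abs_of_pos (inv_pos.2 hN),
    inv_mul_le_iff₀ hN]
  calc |∑ j, (x j - y j)| ≤ ∑ j, |x j - y j| := Finset.abs_sum_le_sum_abs _ _
    _ ≤ ∑ _j : Fin N, δ := Finset.sum_le_sum fun j _ => h j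
    _ = N * δ := by simp

variable {ν : Fin n → Measure (Seg R)} [∀ i, IsFiniteMeasure (ν i)]

lemma IsApproximating.tendsto_mean_eval (hΞ : IsApproximating Ξ ν) (i : Fin n) (p : Polynomial ℝ) :
    Tendsto (fun N => mean fun j => p.eval (Ξ N i j : ℝ)) atTop
      (𝓝 (∫ x, p.eval (x : ℝ) ∂ν i)) := by
  simp only [Polynomial.eval_eq_sum_range]
  rw [integral_finsetSum _ fun k _ => integrable_of_compactSpace (by fun_prop) _]
  have hmean : ∀ N, (mean fun j : Fin N =>
      ∑ k ∈ Finset.range (p.natDegree + 1), p.coeff k * (Ξ N i j : ℝ) ^ k) =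
      ∑ k ∈ Finset.range (p.natDegree + 1),
        p.coeff k * mean fun j : Fin N => (Ξ N i j : ℝ) ^ k := fun N => by
    simp only [mean, Finset.mul_sum]
    rw [Finset.sum_comm]
    simp only [mul_left_comm]
  simp only [hmean, integral_const_mul]
  exact tendsto_finsetSum _ fun k _ => (hΞ.tendsto_moment i k).const_mul _

end Approximation

lemma IsApproximating.tendsto_mean {R : ℝ} {n : ℕ} {Ξ : (N : ℕ) → Fin n → Fin N → Seg R}
    {ν : Fin n → Measure (Seg R)} [∀ i, IsProbabilityMeasure (ν i)] (hΞ : IsApproximating Ξ ν)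
    (i : Fin n) (φ : C(Seg R, ℝ)) :
    Tendsto (fun N => mean fun j => φ (Ξ N i j)) atTop (𝓝 (∫ x, φ x ∂ν i)) := by
  rw [Metric.tendsto_nhds]
  intro ε hε
  obtain ⟨p, hp⟩ := exists_polynomial_near_continuousMap (-R) R φ (ε / 3) (by positivity)
  have hpφ : ∀ x : Seg R, |p.eval (x : ℝ) - φ x| ≤ ε / 3 := fun x =>
    ((p.toContinuousMapOn (Set.Icc (-R) R) - φ).norm_coe_le_norm x).trans hp.le
  have hint : |(∫ x, p.eval (x : ℝ) ∂ν i) - ∫ x, φ x ∂ν i| ≤ ε / 3 := by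
    rw [← integral_sub (integrable_of_compactSpace (by fun_prop) _)
      (integrable_of_compactSpace φ.continuous _)]
    simpa using norm_integral_le_of_norm_le_const (μ := ν i)
      (f := fun x => p.eval (x : ℝ) - φ x) (ae_of_all _ hpφ)
  filter_upwards [Metric.tendsto_nhds.1 (hΞ.tendsto_mean_eval i p) (ε / 3) (by positivity)]
    with N hN
  have hmean : |(mean fun j => p.eval (Ξ N i j : ℝ)) - mean fun j => φ (Ξ N i j)| ≤ ε / 3 :=
    abs_mean_sub_mean_le (by positivity) fun j => hpφ _
  rw [Real.dist_eq, abs_lt] at hN ⊢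
  rw [abs_le] at hint hmean
  constructor <;> linarith [hN.1, hN.2, hint.1, hint.2, hmean.1, hmean.2]

section TypicalSet

variable {R : ℝ} {n N K : ℕ}

/-- The samples `y_1, …, y_N` of points of the cube whose `i`-th coordinates have, for each `i`,
nearly the same sums of the test functions `φ_k` as the vector `ξ_i`. -/
def typicalSet (ξ : Fin n → Fin N → Seg R) (φ : Fin K → C(Seg R, ℝ)) (ε : ℝ) :
    Set (Fin N → Cube R n) :=
  {y | ∀ i k, |∑ j, φ k (y j i) - ∑ j, φ k (ξ i j)| ≤ N * ε}

variable (ξ : Fin n → Fin N → Seg R) (φ : Fin K → C(Seg R, ℝ)) (ε : ℝ)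

lemma measurableSet_typicalSet : MeasurableSet (typicalSet ξ φ ε) := by
  simp only [typicalSet, Set.ofPred_forall]
  exact MeasurableSet.iInter fun i => MeasurableSet.iInter fun k =>
    measurableSet_le (Continuous.measurable (by fun_prop)) measurable_const

lemma permCoord_mem_typicalSet (σ : Fin n → Equiv.Perm (Fin N)) (y : Fin N → Cube R n) :
    (fun j i => y (σ i j) i) ∈ typicalSet ξ φ ε ↔ y ∈ typicalSet ξ φ ε :=
  forall_congr' fun i => forall_congr' fun k => by
    rw [Equiv.sum_comp (σ i) fun j => φ k (y j i)]

end TypicalSet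

instance isProbabilityMeasure_marginal {R : ℝ} {n : ℕ} (μ : Measure (Cube R n))
    [IsProbabilityMeasure μ] (i : Fin n) :
    IsProbabilityMeasure (marginal μ i) :=
  Measure.isProbabilityMeasure_map (measurable_pi_apply i).aemeasurable

lemma eventually_half_le_typicalSet {R : ℝ} {n K : ℕ} {Ξ : (N : ℕ) → Fin n → Fin N → Seg R}
    {Q : Measure (Cube R n)} [IsProbabilityMeasure Q] (hΞ : IsApproximating Ξ (marginal Q))
    (φ : Fin K → C(Seg R, ℝ)) {ε : ℝ} (hε : 0 < ε) :
    ∀ᶠ N : ℕ in atTop,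
      1 / 2 ≤ (Measure.pi fun _ : Fin N => Q).real (typicalSet (Ξ N) φ ε) := by
  let B (N : ℕ) (p : Fin n × Fin K) : Set (Fin N → Cube R n) :=
    {y | N * ε < |∑ j, φ p.2 (y j p.1) - N * mean fun j => φ p.2 (Ξ N p.1 j)|}
  have hB : ∀ p, Tendsto (fun N => (Measure.pi fun _ : Fin N => Q).real (B N p)) atTop (𝓝 0) :=
    fun ⟨i, k⟩ => by
      have hmean := hΞ.tendsto_mean i (φ k)
      rw [marginal, integral_map (measurable_pi_apply i).aemeasurable
        (φ k).continuous.aestronglyMeasurable] at hmean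
      exact tendsto_pi_real_abs_sum_sub_gt Q (ψ := fun x => φ k (x i))
        (MemLp.of_bound (Continuous.aestronglyMeasurable (by fun_prop)) ‖φ k‖
          (ae_of_all _ fun x => (φ k).norm_coe_le_norm _)) hmean hε
  have hsum : Tendsto (fun N => ∑ p, (Measure.pi fun _ : Fin N => Q).real (B N p)) atTop (𝓝 0) := by
    simpa only [Finset.sum_const_zero] using tendsto_finsetSum Finset.univ fun p _ => hB p
  filter_upwards [hsum.eventually_lt_const one_half_pos] with N hN
  have hcompl : (typicalSet (Ξ N) φ ε)ᶜ = ⋃ p, B N p := by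
    ext y
    simp [typicalSet, B, natCast_mul_mean]
  have hle := (measureReal_iUnion_fintype_le (μ := Measure.pi fun _ : Fin N => Q) (B N)).trans hN.le
  rw [← hcompl, probReal_compl_eq_one_sub (measurableSet_typicalSet _ _ _)] at hle
  linarith

section Sandwich

variable {R : ℝ} {n : ℕ} {ν : Fin n → Measure (Seg R)} [∀ i, IsProbabilityMeasure (ν i)]
  {f : C(Cube R n, ℝ)}

lemma integrable_permAverage {N : ℕ} (μ : Measure (Fin N → Cube R n)) [IsFiniteMeasure μ] :
    Integrable (fun y => permAverage (fun i j => y j i) f) μ := by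
  have hswap : Continuous fun (y : Fin N → Cube R n) i j => y j i := by fun_prop
  exact integrable_of_compactSpace ((continuous_permAverage f.continuous).comp hswap) μ

variable (ν f) in
lemma setIntegral_permAverage_typicalSet {N K : ℕ} (ξ : Fin n → Fin N → Seg R)
    (φ : Fin K → C(Seg R, ℝ)) (ε : ℝ) :
    ∫ y in typicalSet ξ φ ε, permAverage (fun i j => y j i) f
        ∂Measure.pi (fun _ : Fin N => Measure.pi ν) =
      (∫ x, Real.exp (f x) ∂Measure.pi ν) ^ N *
        (Measure.pi fun _ : Fin N => (Measure.pi ν).tilted f).real (typicalSet ξ φ ε) := by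
  rw [← setIntegral_exp_sum_eq_permAverage ν f (measurableSet_typicalSet ξ φ ε)
    (permCoord_mem_typicalSet ξ φ ε), setIntegral_exp_sum _ (integrable_exp _), Fintype.card_fin]

lemma permAverage_mul_pi_typicalSet_le {N K : ℕ} {ξ : Fin n → Fin N → Seg R}
    {φ : Fin K → C(Seg R, ℝ)} {ε c : ℝ}
    (h : ∀ y ∈ typicalSet ξ φ ε, permAverage ξ f ≤ c * permAverage (fun i j => y j i) f) :
    permAverage ξ f * (Measure.pi fun _ : Fin N => Measure.pi ν).real (typicalSet ξ φ ε) ≤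
      c * ((∫ x, Real.exp (f x) ∂Measure.pi ν) ^ N *
        (Measure.pi fun _ : Fin N => (Measure.pi ν).tilted f).real (typicalSet ξ φ ε)) := by
  rw [← setIntegral_permAverage_typicalSet, ← integral_const_mul, mul_comm, ← smul_eq_mul,
    ← setIntegral_const]
  exact setIntegral_mono_on (integrable_const _).integrableOn
    ((integrable_permAverage _).const_mul c).integrableOn (measurableSet_typicalSet ξ φ ε) h

lemma pow_mul_pi_tilted_typicalSet_le {N K : ℕ} {ξ : Fin n → Fin N → Seg R}
    {φ : Fin K → C(Seg R, ℝ)} {ε c : ℝ}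
    (h : ∀ y ∈ typicalSet ξ φ ε, permAverage (fun i j => y j i) f ≤ c * permAverage ξ f) :
    (∫ x, Real.exp (f x) ∂Measure.pi ν) ^ N *
        (Measure.pi fun _ : Fin N => (Measure.pi ν).tilted f).real (typicalSet ξ φ ε) ≤
      c * permAverage ξ f *
        (Measure.pi fun _ : Fin N => Measure.pi ν).real (typicalSet ξ φ ε) := by
  rw [← setIntegral_permAverage_typicalSet, mul_comm (c * _), ← smul_eq_mul, ← setIntegral_const]
  exact setIntegral_mono_on (integrable_permAverage _).integrableOn
    (integrable_const _).integrableOn (measurableSet_typicalSet ξ φ ε) h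

lemma eventually_two_le_exp {δ : ℝ} (hδ : 0 < δ) : ∀ᶠ N : ℕ in atTop, 2 ≤ Real.exp (N * δ) :=
  (Real.tendsto_exp_atTop.comp
    (tendsto_natCast_atTop_atTop.atTop_mul_const hδ)).eventually_ge_atTop 2

lemma integral_exp_pow {S : Type*} [MeasurableSpace S] {μ : Measure S} [NeZero μ] {u : S → ℝ}
    (hu : Integrable (fun x => Real.exp (u x)) μ) (N : ℕ) :
    (∫ x, Real.exp (u x) ∂μ) ^ N = Real.exp (N * Real.log (∫ x, Real.exp (u x) ∂μ)) := by
  rw [Real.exp_nat_mul, Real.exp_log (integral_exp_pos hu)]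

variable {Ξ : (N : ℕ) → Fin n → Fin N → Seg R}

lemma eventually_mutualPressureTerm_le (hΞ : IsApproximating Ξ ν) {δ : ℝ} (hδ : 0 < δ) :
    ∀ᶠ N in atTop, mutualPressureTerm (Ξ N) f ≤
      Real.log (∫ x, Real.exp (f x) ∂Measure.pi ν) + δ := by
  obtain ⟨K, φ, ε, hε, hcmp⟩ := exists_permAverage_comparison f (half_pos hδ)
  have hmarg : marginal (Measure.pi ν) = ν :=
    funext fun i => (measurePreserving_eval ν i).map_eq
  have : IsProbabilityMeasure ((Measure.pi ν).tilted f) :=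
    isProbabilityMeasure_tilted (integrable_exp _)
  filter_upwards [eventually_half_le_typicalSet (hmarg.symm ▸ hΞ) φ hε,
    eventually_two_le_exp (half_pos hδ), eventually_ne_atTop 0] with N hhalf htwo hN
  rw [mutualPressureTerm_le_iff hN]
  have hle := permAverage_mul_pi_typicalSet_le (ν := ν) fun y hy =>
    (hcmp N _ (Ξ N) (hΞ.monotone N) hy).2
  calc permAverage (Ξ N) f = 2 * (permAverage (Ξ N) f * (1 / 2)) := by ring
    _ ≤ 2 * (Real.exp (N * (δ / 2)) * ((∫ x, Real.exp (f x) ∂Measure.pi ν) ^ N * 1)) := by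
        gcongr 2 * ?_
        refine (mul_le_mul_of_nonneg_left hhalf (permAverage_pos _ _).le).trans (hle.trans ?_)
        gcongr
        exact measureReal_le_one
    _ ≤ Real.exp (N * (δ / 2)) *
          (Real.exp (N * (δ / 2)) * ((∫ x, Real.exp (f x) ∂Measure.pi ν) ^ N * 1)) := by
        gcongr
    _ = Real.exp (N * (Real.log (∫ x, Real.exp (f x) ∂Measure.pi ν) + δ)) := by
        rw [integral_exp_pow (integrable_exp _), mul_one, ← Real.exp_add, ← Real.exp_add]
        ring_nf

lemma eventually_le_mutualPressureTerm (hΞ : IsApproximating Ξ ν)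
    (hf : marginal ((Measure.pi ν).tilted f) = ν) {δ : ℝ} (hδ : 0 < δ) :
    ∀ᶠ N in atTop, Real.log (∫ x, Real.exp (f x) ∂Measure.pi ν) - δ ≤
      mutualPressureTerm (Ξ N) f := by
  obtain ⟨K, φ, ε, hε, hcmp⟩ := exists_permAverage_comparison f (half_pos hδ)
  have : IsProbabilityMeasure ((Measure.pi ν).tilted f) :=
    isProbabilityMeasure_tilted (integrable_exp _)
  filter_upwards [eventually_half_le_typicalSet (hf.symm ▸ hΞ) φ hε,
    eventually_two_le_exp (half_pos hδ), eventually_ne_atTop 0] with N hhalf htwo hN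
  rw [le_mutualPressureTerm_iff hN]
  have hle := pow_mul_pi_tilted_typicalSet_le (ν := ν) fun y hy =>
    (hcmp N _ (Ξ N) (hΞ.monotone N) hy).1
  have hpos := permAverage_pos (Ξ N) f
  have hpow : Real.exp (N * Real.log (∫ x, Real.exp (f x) ∂Measure.pi ν)) * (1 / 2) ≤
      Real.exp (N * (δ / 2)) * permAverage (Ξ N) f := by
    rw [← integral_exp_pow (integrable_exp _)]
    exact (mul_le_mul_of_nonneg_left hhalf (by positivity)).trans
      (hle.trans (mul_le_of_le_one_right (by positivity) measureReal_le_one))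
  calc Real.exp (N * (Real.log (∫ x, Real.exp (f x) ∂Measure.pi ν) - δ))
      = Real.exp (-(N * δ)) * (2 *
          (Real.exp (N * Real.log (∫ x, Real.exp (f x) ∂Measure.pi ν)) * (1 / 2))) := by
        rw [mul_sub, sub_eq_neg_add, Real.exp_add]
        ring
    _ ≤ Real.exp (-(N * δ)) *
          (Real.exp (N * (δ / 2)) * (Real.exp (N * (δ / 2)) * permAverage (Ξ N) f)) := by
        gcongr
    _ = permAverage (Ξ N) f := by
        rw [← mul_assoc, ← mul_assoc, ← Real.exp_add, ← Real.exp_add]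
        ring_nf
        simp

end Sandwich

section Limsup

variable {R : ℝ} {n : ℕ} {Ξ : (N : ℕ) → Fin n → Fin N → Seg R} {f : C(Cube R n, ℝ)}

lemma isBoundedUnder_le_mutualPressureTerm :
    IsBoundedUnder (· ≤ ·) atTop fun N => mutualPressureTerm (Ξ N) f :=
  ⟨‖f‖, eventually_map.2 ((eventually_ne_atTop 0).mono fun _ hN =>
    (abs_le.1 (abs_mutualPressureTerm_le hN)).2)⟩

lemma isCoboundedUnder_le_mutualPressureTerm :
    IsCoboundedUnder (· ≤ ·) atTop fun N => mutualPressureTerm (Ξ N) f :=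
  IsBoundedUnder.isCoboundedUnder_le ⟨-‖f‖, eventually_map.2 ((eventually_ne_atTop 0).mono
    fun _ hN => (abs_le.1 (abs_mutualPressureTerm_le hN)).1)⟩

lemma mutualPressure_le_of_eventually {b : ℝ}
    (h : ∀ δ > 0, ∀ᶠ N in atTop, mutualPressureTerm (Ξ N) f ≤ b + δ) :
    mutualPressure Ξ f ≤ b :=
  le_of_forall_pos_le_add fun δ hδ =>
    limsup_le_of_le isCoboundedUnder_le_mutualPressureTerm (h δ hδ)

lemma le_mutualPressure_of_eventually {b : ℝ}
    (h : ∀ δ > 0, ∀ᶠ N in atTop, b - δ ≤ mutualPressureTerm (Ξ N) f) :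
    b ≤ mutualPressure Ξ f :=
  le_of_forall_sub_le fun δ hδ =>
    le_limsup_of_frequently_le (h δ hδ).frequently isBoundedUnder_le_mutualPressureTerm

lemma eventually_mutualPressureTerm_lt {δ : ℝ} (hδ : 0 < δ) :
    ∀ᶠ N in atTop, mutualPressureTerm (Ξ N) f < mutualPressure Ξ f + δ :=
  eventually_lt_of_limsup_lt (lt_add_of_pos_right _ hδ) isBoundedUnder_le_mutualPressureTerm

lemma convexOn_mutualPressure : ConvexOn ℝ Set.univ (mutualPressure Ξ) := by
  refine ⟨convex_univ, fun f _ g _ a b ha hb hab =>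
    mutualPressure_le_of_eventually fun δ hδ => ?_⟩
  filter_upwards [eventually_mutualPressureTerm_lt (f := f) hδ,
    eventually_mutualPressureTerm_lt (f := g) hδ] with N hf hg
  calc mutualPressureTerm (Ξ N) (a • f + b • g)
      ≤ a • mutualPressureTerm (Ξ N) f + b • mutualPressureTerm (Ξ N) g :=
        (convexOn_mutualPressureTerm (Ξ N)).2 (Set.mem_univ f) (Set.mem_univ g) ha hb hab
    _ ≤ a • (mutualPressure Ξ f + δ) + b • (mutualPressure Ξ g + δ) := by gcongr
    _ = a • mutualPressure Ξ f + b • mutualPressure Ξ g + δ := by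
        rw [smul_add, smul_add, add_add_add_comm, ← add_smul, hab, one_smul]

variable {ν : Fin n → Measure (Seg R)} [∀ i, IsProbabilityMeasure (ν i)]

lemma mutualPressure_le_log_integral_exp (hΞ : IsApproximating Ξ ν) :
    mutualPressure Ξ f ≤ Real.log (∫ x, Real.exp (f x) ∂Measure.pi ν) :=
  mutualPressure_le_of_eventually fun _ hδ => eventually_mutualPressureTerm_le hΞ hδ

lemma mutualPressure_eq_log_integral_exp (hΞ : IsApproximating Ξ ν)
    (hf : marginal ((Measure.pi ν).tilted f) = ν) :
    mutualPressure Ξ f = Real.log (∫ x, Real.exp (f x) ∂Measure.pi ν) :=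
  (mutualPressure_le_log_integral_exp hΞ).antisymm
    (le_mutualPressure_of_eventually fun _ hδ => eventually_le_mutualPressureTerm hΞ hf hδ)

end Limsup

section Subgradient

lemma forall_add_mul_le_iff_eq_of_hasDerivAt {p q : ℝ → ℝ} {a d : ℝ}
    (hp : ConvexOn ℝ Set.univ p) (hpq : ∀ t, p t ≤ q t) (h0 : p 0 = q 0)
    (hq : HasDerivAt q d 0) : (∀ t, p 0 + t * a ≤ p t) ↔ a = d := by
  constructor
  · intro h
    have hmin : IsLocalMin (fun t => q t - t * a) 0 := Eventually.of_forall fun t => by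
      linarith [h t, hpq t]
    have := hmin.hasDerivAt_eq_zero (hq.sub ((hasDerivAt_id 0).mul_const a))
    linarith
  · rintro rfl t
    have hcomp : HasDerivAt (fun s => q (-t * s)) (a * -t) 0 :=
      HasDerivAt.comp 0 (by simpa using hq) (hasDerivAt_const_mul (-t))
    have hslope : ∀ᶠ s : ℝ in 𝓝[>] 0,
        p 0 - p t ≤ s⁻¹ • (q (-t * (0 + s)) - q (-t * 0)) := by
      filter_upwards [self_mem_nhdsWithin] with s (hs : 0 < s)
      -- Convexity at `-t * s`, `0`, `t` turns the upper bound `q` on one side of `0` into a lower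
      -- bound for `p` on the other side.
      have hweights : 1 / (1 + s) + s / (1 + s) = 1 := by field_simp
      have hconv := hp.2 (Set.mem_univ (-t * s)) (Set.mem_univ t) (by positivity) (by positivity)
        hweights
      have hzero : (1 / (1 + s)) • (-t * s) + (s / (1 + s)) • t = 0 := by
        simp only [smul_eq_mul]
        ring
      rw [hzero, smul_eq_mul, smul_eq_mul, div_mul_eq_mul_div, div_mul_eq_mul_div, ← add_div,
        le_div_iff₀ (by positivity)] at hconv
      rw [zero_add, mul_zero, ← h0, smul_eq_mul, le_inv_mul_iff₀ hs]
      linarith [hpq (-t * s)]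
    have := ge_of_tendsto hcomp.tendsto_slope_zero_right hslope
    linarith

lemma hasDerivAt_cgf_zero {X : Type*} [TopologicalSpace X] [CompactSpace X] [MeasurableSpace X]
    [OpensMeasurableSpace X] (f : C(X, ℝ)) (μ : Measure X) [IsProbabilityMeasure μ] :
    HasDerivAt (cgf f μ) (∫ x, f x ∂μ) 0 := by
  have hmem : (0 : ℝ) ∈ interior (integrableExpSet f μ) := by
    have huniv : integrableExpSet f μ = Set.univ :=
      Set.eq_univ_of_forall fun t => integrable_of_compactSpace (by fun_prop) μ
    simp [huniv]
  have hderiv := deriv_cgf_zero hmem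
  rw [probReal_univ, div_one] at hderiv
  exact hderiv ▸ (analyticAt_cgf hmem).differentiableAt.hasDerivAt

variable {R : ℝ} {n : ℕ} {Ξ : (N : ℕ) → Fin n → Fin N → Seg R} {μ : Measure (Cube R n)}

lemma isMutuallyEquilibrium_iff {h : C(Cube R n, ℝ)} :
    IsMutuallyEquilibrium Ξ μ h ↔ ∀ f : C(Cube R n, ℝ),
      (∫ x, f x ∂μ) - mutualPressure Ξ f ≤ (∫ x, h x ∂μ) - mutualPressure Ξ h := by
  simp only [← EReal.coe_le_coe_iff]
  exact ⟨fun he => iSup_le_iff.1 he.le, fun hle => (iSup_le hle).antisymm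
    (le_iSup (fun f : C(Cube R n, ℝ) => (((∫ x, f x ∂μ) - mutualPressure Ξ f : ℝ) : EReal)) h)⟩

lemma isMutuallyEquilibrium_iff_forall_add_smul [IsFiniteMeasure μ] {g : C(Cube R n, ℝ)} :
    IsMutuallyEquilibrium Ξ μ g ↔ ∀ (f : C(Cube R n, ℝ)) (t : ℝ),
      mutualPressure Ξ g + t * ∫ x, f x ∂μ ≤ mutualPressure Ξ (g + t • f) := by
  have hint : ∀ (f : C(Cube R n, ℝ)) (t : ℝ),
      ∫ x, (g + t • f) x ∂μ = (∫ x, g x ∂μ) + t * ∫ x, f x ∂μ := fun f t => by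
    rw [← integral_const_mul, ← integral_add (integrable_of_compactSpace g.continuous μ)
      (integrable_of_compactSpace (by fun_prop) μ)]
    rfl
  rw [isMutuallyEquilibrium_iff]
  constructor
  · intro h f t
    linarith [h (g + t • f), hint f t]
  · intro h f
    have hf := h (f - g) 1
    have hintf := hint (f - g) 1
    rw [one_smul, add_sub_cancel] at hf hintf
    linarith

variable {ν : Fin n → Measure (Seg R)} [∀ i, IsProbabilityMeasure (ν i)] {g : C(Cube R n, ℝ)}

lemma mutualPressure_add_smul_le (hΞ : IsApproximating Ξ ν)
    (hg : marginal ((Measure.pi ν).tilted g) = ν) (f : C(Cube R n, ℝ)) (t : ℝ) :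
    mutualPressure Ξ (g + t • f) ≤
      mutualPressure Ξ g + cgf f ((Measure.pi ν).tilted g) t := by
  have hpos : ∀ u : C(Cube R n, ℝ), 0 < ∫ x, Real.exp (u x) ∂Measure.pi ν := fun u =>
    integral_exp_pos (integrable_exp _)
  have hmgf : mgf f ((Measure.pi ν).tilted g) t =
      (∫ x, Real.exp ((g + t • f) x) ∂Measure.pi ν) / ∫ x, Real.exp (g x) ∂Measure.pi ν :=
    integral_exp_tilted g fun x => t * f x
  rw [cgf, hmgf, Real.log_div (hpos _).ne' (hpos g).ne',
    ← mutualPressure_eq_log_integral_exp hΞ hg, add_sub_cancel]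
  exact mutualPressure_le_log_integral_exp hΞ

lemma isMutuallyEquilibrium_iff_eq_tilted [IsFiniteMeasure μ] (hΞ : IsApproximating Ξ ν)
    (hg : marginal ((Measure.pi ν).tilted g) = ν) :
    IsMutuallyEquilibrium Ξ μ g ↔ μ = (Measure.pi ν).tilted g := by
  have hprob : IsProbabilityMeasure ((Measure.pi ν).tilted g) :=
    isProbabilityMeasure_tilted (integrable_exp _)
  have hsubgradient : ∀ f : C(Cube R n, ℝ),
      (∀ t : ℝ, mutualPressure Ξ g + t * ∫ x, f x ∂μ ≤ mutualPressure Ξ (g + t • f)) ↔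
        ∫ x, f x ∂μ = ∫ x, f x ∂(Measure.pi ν).tilted g := fun f => by
    have hconv : ConvexOn ℝ Set.univ fun t : ℝ => mutualPressure Ξ (g + t • f) := by
      simpa [Function.comp_def, AffineMap.lineMap_apply, add_comm] using
        convexOn_mutualPressure.comp_affineMap (AffineMap.lineMap (k := ℝ) g (g + f))
    simpa using forall_add_mul_le_iff_eq_of_hasDerivAt hconv
      (mutualPressure_add_smul_le hΞ hg f) (by simp) ((hasDerivAt_cgf_zero f _).const_add _)
  rw [isMutuallyEquilibrium_iff_forall_add_smul, forall_congr' hsubgradient]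
  exact ⟨fun h => ext_of_forall_integral_eq_of_IsFiniteMeasure fun f => h f.toContinuousMap,
    fun h f => by rw [h]⟩

end Subgradient

section Separable

variable {R : ℝ} {n : ℕ}

/-- The sum `∑ i, v_i(x_i)` of functions of the single coordinates. -/
def separable (v : Fin n → C(Seg R, ℝ)) : C(Cube R n, ℝ) :=
  ⟨fun x => ∑ i, v i (x i), by fun_prop⟩

lemma integral_separable (μ : Measure (Cube R n)) [IsFiniteMeasure μ]
    (v : Fin n → C(Seg R, ℝ)) :
    ∫ x, separable v x ∂μ = ∑ i, ∫ x, v i x ∂marginal μ i := by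
  rw [separable, ContinuousMap.coe_mk,
    integral_finsetSum _ fun i _ => integrable_of_compactSpace (by fun_prop) μ]
  exact Finset.sum_congr rfl fun i _ => (integral_map (measurable_pi_apply i).aemeasurable
    (v i).continuous.aestronglyMeasurable).symm

lemma permAverage_add_separable {N : ℕ} (ξ : Fin n → Fin N → Seg R) (f : C(Cube R n, ℝ))
    (v : Fin n → C(Seg R, ℝ)) :
    permAverage ξ (f + separable v) =
      Real.exp (∑ i, ∑ j, v i (ξ i j)) * permAverage ξ f := by
  have hsum : ∀ σ : Fin n → Equiv.Perm (Fin N),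
      ∑ j, separable v (fun i => ξ i ((σ i)⁻¹ j)) = ∑ i, ∑ j, v i (ξ i j) := fun σ => by
    simp only [separable, ContinuousMap.coe_mk]
    rw [Finset.sum_comm]
    exact Finset.sum_congr rfl fun i _ => Equiv.sum_comp (σ i)⁻¹ fun j => v i (ξ i j)
  simp only [permAverage, Pi.add_apply, Finset.sum_add_distrib, hsum, Real.exp_add,
    ← Finset.expect_mul]
  rw [mul_comm]

lemma mutualPressureTerm_add_separable {N : ℕ} (ξ : Fin n → Fin N → Seg R)
    (f : C(Cube R n, ℝ)) (v : Fin n → C(Seg R, ℝ)) :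
    mutualPressureTerm ξ (f + separable v) =
      mutualPressureTerm ξ f + ∑ i, mean fun j => v i (ξ i j) := by
  simp only [mutualPressureTerm_eq, ContinuousMap.coe_add, permAverage_add_separable, mean,
    Real.log_mul (Real.exp_pos _).ne' (permAverage_pos ξ f).ne', Real.log_exp, ← Finset.mul_sum]
  ring

variable {Ξ : (N : ℕ) → Fin n → Fin N → Seg R} {ν : Fin n → Measure (Seg R)}
  [∀ i, IsProbabilityMeasure (ν i)]

lemma mutualPressure_add_separable_le (hΞ : IsApproximating Ξ ν) (f : C(Cube R n, ℝ))
    (v : Fin n → C(Seg R, ℝ)) :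
    mutualPressure Ξ (f + separable v) ≤ mutualPressure Ξ f + ∑ i, ∫ x, v i x ∂ν i := by
  have hmean : Tendsto (fun N => ∑ i, mean fun j => v i (Ξ N i j)) atTop
      (𝓝 (∑ i, ∫ x, v i x ∂ν i)) :=
    tendsto_finsetSum _ fun i _ => hΞ.tendsto_mean i (v i)
  refine mutualPressure_le_of_eventually fun δ hδ => ?_
  filter_upwards [eventually_mutualPressureTerm_lt (Ξ := Ξ) (f := f) (half_pos hδ),
    hmean.eventually_lt_const (lt_add_of_pos_right _ (half_pos hδ))] with N hterm hN
  rw [mutualPressureTerm_add_separable]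
  linarith

lemma mutualPressure_add_separable (hΞ : IsApproximating Ξ ν) (f : C(Cube R n, ℝ))
    (v : Fin n → C(Seg R, ℝ)) :
    mutualPressure Ξ (f + separable v) = mutualPressure Ξ f + ∑ i, ∫ x, v i x ∂ν i := by
  refine (mutualPressure_add_separable_le hΞ f v).antisymm ?_
  have hcancel : f + separable v + separable (-v) = f := by
    ext x
    simp [separable]
  have hneg := mutualPressure_add_separable_le hΞ (f + separable v) (-v)
  simp only [hcancel, Pi.neg_apply, ContinuousMap.neg_apply, integral_neg,
    Finset.sum_neg_distrib] at hneg
  linarith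

lemma isMutuallyEquilibrium_add_separable_iff {μ : Measure (Cube R n)} [IsProbabilityMeasure μ]
    (hΞ : IsApproximating Ξ (marginal μ)) (f : C(Cube R n, ℝ)) (v : Fin n → C(Seg R, ℝ)) :
    IsMutuallyEquilibrium Ξ μ (f + separable v) ↔ IsMutuallyEquilibrium Ξ μ f := by
  simp only [IsMutuallyEquilibrium, ContinuousMap.add_apply]
  rw [integral_add (integrable_of_compactSpace f.continuous μ)
    (integrable_of_compactSpace (separable v).continuous μ), integral_separable,
    mutualPressure_add_separable hΞ, add_sub_add_right_eq_sub]

end Separable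

section Tilted

variable {X Y : Type*} [MeasurableSpace X] [MeasurableSpace Y]

lemma map_tilted_comp {μ : Measure X} {ρ : Measure Y} {e : X → Y} (he : MeasurePreserving e μ ρ)
    {F : Y → ℝ} (hF : Measurable F) : (μ.tilted (F ∘ e)).map e = ρ.tilted F := by
  have hmass : ∫ x, Real.exp (F (e x)) ∂μ = ∫ y, Real.exp (F y) ∂ρ := by
    rw [← he.map_eq, integral_map he.aemeasurable (by fun_prop)]
  ext s hs
  rw [Measure.map_apply he.measurable hs, tilted_apply' _ _ (he.measurable hs),
    tilted_apply' _ _ hs, ← he.setLIntegral_comp_preimage hs (by fun_prop)]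
  simp only [Function.comp_apply, hmass]

lemma fst_prod_tilted (μ : Measure X) (ρ : Measure Y) [SFinite μ] [SFinite ρ] [NeZero ρ]
    {F : X × Y → ℝ} (hF : Integrable (fun p => Real.exp (F p)) (μ.prod ρ)) :
    ((μ.prod ρ).tilted F).fst =
      μ.tilted fun x => Real.log (∫ y, Real.exp (F (x, y)) ∂ρ) := by
  have hexp : (fun x => Real.exp (Real.log (∫ y, Real.exp (F (x, y)) ∂ρ))) =ᵐ[μ]
      fun x => ∫ y, Real.exp (F (x, y)) ∂ρ := by
    filter_upwards [hF.prod_right_ae] with x hx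
    exact Real.exp_log (integral_exp_pos hx)
  ext s hs
  rw [Measure.fst_apply hs, tilted_apply_eq_ofReal_integral, tilted_apply_eq_ofReal_integral,
    integral_div, integral_div, integral_congr_ae hexp,
    integral_congr_ae (ae_restrict_of_ae hexp), ← integral_prod _ hF, ← Set.prod_univ,
    setIntegral_prod _ hF.integrableOn]
  simp only [Measure.restrict_univ]

end Tilted

instance neZero_pi {ι : Type*} [Fintype ι] {X : ι → Type*} [∀ i, MeasurableSpace (X i)]
    (μ : ∀ i, Measure (X i)) [∀ i, SigmaFinite (μ i)] [∀ i, NeZero (μ i)] :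
    NeZero (Measure.pi μ) := by
  refine ⟨Measure.measure_univ_ne_zero.1 ?_⟩
  rw [Measure.pi_univ]
  exact Finset.prod_ne_zero_iff.2 fun i _ => Measure.measure_univ_ne_zero.2 (NeZero.ne (μ i))

section Gibbs

instance isFiniteMeasure_volume_seg (R : ℝ) : IsFiniteMeasure (volume : Measure (Seg R)) :=
  ⟨by
    rw [Measure.Subtype.volume_univ measurableSet_Icc.nullMeasurableSet]
    exact measure_Icc_lt_top⟩

variable {R : ℝ} {n : ℕ}

lemma neZero_volume_seg (hR : 0 < R) : NeZero (volume : Measure (Seg R)) := by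
  refine ⟨Measure.measure_univ_ne_zero.1 ?_⟩
  rw [Measure.Subtype.volume_univ measurableSet_Icc.nullMeasurableSet, Real.volume_Icc]
  simpa using by linarith

lemma continuous_insertCoord (i : Fin n) :
    Continuous fun p : Seg R × ({j : Fin n // j ≠ i} → Seg R) => insertCoord i p.1 p.2 := by
  refine continuous_pi fun j => ?_
  by_cases hj : j = i <;>
    simp only [insertCoord, hj, dite_true, dite_false] <;> fun_prop

lemma measurePreserving_insertCoord (ν : Fin n → Measure (Seg R)) [∀ i, SigmaFinite (ν i)]
    (i : Fin n) :
    MeasurePreserving (fun p : Seg R × ({j : Fin n // j ≠ i} → Seg R) => insertCoord i p.1 p.2)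
      ((ν i).prod (Measure.pi fun j => ν j)) (Measure.pi ν) := by
  have hsplit := measurePreserving_piEquivPiSubtypeProd ν (· = i)
  have hunique := measurePreserving_piUnique fun j : {j : Fin n // j = i} => ν j
  rw [Subsingleton.elim (Fintype.subtypeEq i) (Subtype.fintype (· = i))] at hunique
  exact (hsplit.symm _).comp ((hunique.symm _).prod (MeasurePreserving.id _))

lemma marginal_pi_tilted (ν : Fin n → Measure (Seg R)) [∀ i, IsFiniteMeasure (ν i)]
    [∀ i, NeZero (ν i)] (h : C(Cube R n, ℝ)) (i : Fin n) :
    marginal ((Measure.pi ν).tilted h) i = (ν i).tilted fun x =>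
      Real.log (∫ y, Real.exp (h (insertCoord i x y))
        ∂Measure.pi fun j : {j : Fin n // j ≠ i} => ν j) := by
  have hins := measurePreserving_insertCoord ν i
  have hcoord : (fun x : Cube R n => x i) ∘ (fun p : Seg R × ({j : Fin n // j ≠ i} → Seg R) =>
      insertCoord i p.1 p.2) = Prod.fst := by
    ext p
    simp [insertCoord]
  have hcont := h.continuous.comp (continuous_insertCoord i)
  rw [marginal, ← map_tilted_comp hins h.continuous.measurable,
    Measure.map_map (measurable_pi_apply i) hins.measurable, hcoord]
  exact fst_prod_tilted _ _ (integrable_of_compactSpace (Real.continuous_exp.comp hcont) _)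

lemma marginal_gibbsMeasure (hR : 0 < R) (h : C(Cube R n, ℝ)) (i : Fin n) :
    marginal (gibbsMeasure h) i = gibbsMeasure (marginalPotential h i) :=
  have := neZero_volume_seg hR
  marginal_pi_tilted (fun _ => volume) h i

lemma continuous_marginalPotential (hR : 0 < R) (h : C(Cube R n, ℝ)) (i : Fin n) :
    Continuous (marginalPotential h i) := by
  have := neZero_volume_seg hR
  have hpi : NeZero (volume : Measure ({j : Fin n // j ≠ i} → Seg R)) := neZero_pi _
  have hcont : Continuous fun p : Seg R × ({j : Fin n // j ≠ i} → Seg R) =>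
      Real.exp (h (insertCoord i p.1 p.2)) :=
    Real.continuous_exp.comp (h.continuous.comp (continuous_insertCoord i))
  have hint := continuous_parametric_integral_of_continuous (μ := volume)
    (f := fun x y => Real.exp (h (insertCoord i x y))) hcont isCompact_univ
  rw [Measure.restrict_univ] at hint
  exact hint.log fun x => (integral_exp_pos (integrable_of_compactSpace
    (hcont.comp (Continuous.prodMk_right x)) _)).ne'

lemma gibbsMeasure_eq_tilted_sub_separable (h : C(Cube R n, ℝ)) (w : Fin n → C(Seg R, ℝ)) :
    gibbsMeasure h = (Measure.pi fun i => gibbsMeasure (w i)).tilted ⇑(h - separable w) := by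
  have hpi : (Measure.pi fun i => gibbsMeasure (w i)) = volume.tilted (separable w) :=
    pi_tilted (fun _ => volume) fun i => w i
  rw [hpi, tilted_tilted (integrable_exp _), ← ContinuousMap.coe_add, add_sub_cancel]
  rfl

end Gibbs

end MutualPressure

end

open MutualPressure MeasureTheory in
theorem proposition3p6 (R : ℝ) (hR : 0 < R) (n : ℕ)
    (h : C(MutualPressure.Cube R n, ℝ))
    (μ : MeasureTheory.Measure (MutualPressure.Cube R n))
    (hμ : MeasureTheory.IsProbabilityMeasure μ)
    (Ξ : (N : ℕ) → Fin n → Fin N → MutualPressure.Seg R)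
    (hΞ : MutualPressure.IsApproximating Ξ (MutualPressure.marginal μ)) :
    μ = MutualPressure.gibbsMeasure h ↔
      MutualPressure.IsMutuallyEquilibrium Ξ μ h ∧
        ∀ i : Fin n, MutualPressure.marginal μ i =
          MutualPressure.gibbsMeasure (MutualPressure.marginalPotential h i) := by
  let w (i : Fin n) : C(Seg R, ℝ) := ⟨marginalPotential h i, continuous_marginalPotential hR h i⟩
  have hmarginal : marginal (gibbsMeasure h) = fun i => gibbsMeasure (w i) :=
    funext fun i => marginal_gibbsMeasure hR h i
  have hequilibrium (hm : marginal μ = fun i => gibbsMeasure (w i)) :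
      IsMutuallyEquilibrium Ξ μ h ↔ μ = gibbsMeasure h := by
    have htilted := gibbsMeasure_eq_tilted_sub_separable h w
    rw [htilted, ← hm] at hmarginal
    rw [htilted, ← hm, ← isMutuallyEquilibrium_iff_eq_tilted hΞ hmarginal,
      ← isMutuallyEquilibrium_add_separable_iff hΞ (h - separable w) w, sub_add_cancel]
  constructor
  · intro hG
    have hm := (congrArg marginal hG).trans hmarginal
    exact ⟨(hequilibrium hm).2 hG, congrFun hm⟩
  · rintro ⟨he, hm⟩
    exact (hequilibrium (funext hm)).1 he
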